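/- Let $0<\delta<1$. There is a constant $L=L(\delta)$ such that for every positive integer $b$ there is an integer $n_0=n_0(\delta,b)$ with the following property. Let $G$ be a finite simple graph on $n\ge n_0$ vertices with minimum degree at least $\delta n$ and chromatic number $\chi(G)>2(b+1)/\delta$. Consider the $(1:b)$ Maker–Breaker game on $V(G)$: Maker and Breaker alternately claim previously unclaimed vertices of $G$, Maker moving first, with Maker claiming exactly one vertex per turn and Breaker exactly $b$ vertices per turn (all the remaining ones if fewer than $b$ are left), until all vertices are claimed. Then Maker has a strategy which guarantees, however Breaker plays, that the vertices claimed by Maker contain the vertex set of an odd cycle of $G$ of length at most $L$. -/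

import Mathlib

namespace MakerBreaker

/-- A position of a Maker-Breaker game on the board `X`: the elements that each of the two
players has claimed so far. -/
structure Position (X : Type*) where
  maker : Finset X
  breaker : Finset X

/-- The elements that nobody has claimed yet. -/
def Position.free {X : Type*} [Fintype X] [DecidableEq X] (p : Position X) : Finset X :=
  (p.maker ∪ p.breaker)ᶜ

/-- The set `S` is a legal turn at `p` for a player who claims `k` elements per turn: it consists
of exactly `k` unclaimed elements, or of all the unclaimed elements if fewer than `k` are left. -/
def IsTurn {X : Type*} [Fintype X] [DecidableEq X] (k : ℕ) (p : Position X) (S : Finset X) :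
    Prop :=
  S ⊆ p.free ∧ S.card = min k p.free.card

/-- A strategy (of either player) prescribes the set of elements to claim in each position at
which it is the player's turn. -/
abbrev Strategy (X : Type*) := Position X → Finset X

/-- The strategy only makes legal turns of `k` elements. -/
def Strategy.IsLegal {X : Type*} [Fintype X] [DecidableEq X] (k : ℕ) (s : Strategy X) : Prop :=
  ∀ p : Position X, IsTurn k p (s p)

/-- The position after Maker, following `σ`, has made a turn at `p`. -/
def makerTurn {X : Type*} [DecidableEq X] (σ : Strategy X) (p : Position X) : Position X :=
  ⟨p.maker ∪ σ p, p.breaker⟩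

/-- The position after Breaker, following `τ`, has made a turn at `p`. -/
def breakerTurn {X : Type*} [DecidableEq X] (τ : Strategy X) (p : Position X) : Position X :=
  ⟨p.maker, p.breaker ∪ τ p⟩

/-- The position after `m` rounds, in each of which Maker moves first, following `σ`, and then
Breaker moves, following `τ`. At the start nothing is claimed. Once the board is exhausted, legal
turns are empty and the position does not change any more. -/
def play {X : Type*} [DecidableEq X] (σ τ : Strategy X) : ℕ → Position X
  | 0 => ⟨∅, ∅⟩
  | m + 1 => breakerTurn τ (makerTurn σ (play σ τ m))

/-- Maker, moving first, has a winning strategy in the `(a : b)` Maker-Breaker game on the board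
`X` with the family `𝓕` of winning sets: a legal strategy with which, however Breaker plays, he
fully claims some winning set in the course of the play. -/
def MakerHasWinningStrategy {X : Type*} [Fintype X] [DecidableEq X] (a b : ℕ)
    (𝓕 : Set (Finset X)) : Prop :=
  ∃ σ : Strategy X, σ.IsLegal a ∧
    ∀ τ : Strategy X, τ.IsLegal b → ∃ m : ℕ, ∃ F ∈ 𝓕, F ⊆ (play σ τ m).maker

/-- The vertex sets of the odd cycles of `G` of length at most `L`. -/
def oddCycleVertexSets {V : Type*} [DecidableEq V] (G : SimpleGraph V) (L : ℕ) :
    Set (Finset V) :=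
  {F | ∃ (v : V) (c : G.Walk v v),
    c.IsCycle ∧ Odd c.length ∧ c.length ≤ L ∧ F = c.support.toFinset}

end MakerBreaker

/-!
Call two vertices connected at level `0` if they have at least `t` common neighbours, and connected
at level `j + 1` if they are so at level `j` or if at least `t` vertices are connected at level `j`
to both of them (`MakerBreaker.Reach`). If `t` is larger than the total number of claims made, Maker
can join two connected vertices that he owns by an even walk of length at most `2 ^ (j + 1)`, all
of whose vertices he owns: a suitable middle vertex is always free, and the two halves are treated
recursively (`MakerBreaker.MakerForces.of_reach`). So it suffices that Maker obtains two adjacent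
vertices that are connected at a level depending on `δ` only; the odd closed walk that he then
builds contains an odd cycle which is no longer (`MakerBreaker.exists_mem_oddCycleVertexSets`).

For this, the vertices are split into at most `2 / δ` classes such that any two vertices of a class
are connected at level `⌊2 / δ⌋ + 2` (`MakerBreaker.exists_classes`). By the minimum degree, at
most `2 / δ` neighbourhoods can have pairwise small intersections
(`MakerBreaker.card_mul_minDegree_le`), which bounds the number of classes, and each vertex is
connected at level `0` to linearly many others (`MakerBreaker.minDegree_mul_minDegree_le`), which
allows the closed classes found by an extremal argument to absorb all remaining vertices.

If every vertex had at most `b` neighbours in its own class, greedy colouring with `b + 1` colours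
per class would give `χ(G) ≤ 2 (b + 1) / δ`. Hence some vertex has more than `b` neighbours in its
own class. Maker claims it, and Breaker's reply cannot occupy all of these neighbours.

A constant `t` depending on `δ` and `b` is enough: it is small compared with the order of `G` when
that order is large.
-/

namespace MakerBreaker

/-! ### Games -/

section Game

variable {X : Type*} [Fintype X] [DecidableEq X]

/-- Maker, to move in the position `p` of the `(a : b)` game with winning sets `𝓕`, can force the
full claim of a winning set. The predicate is inductive, so only finitely many rounds are
needed. -/
inductive MakerForces (a b : ℕ) (𝓕 : Set (Finset X)) : Position X → Prop
  | claimed {p : Position X} (F : Finset X) (hF : F ∈ 𝓕) (hp : F ⊆ p.maker) : MakerForces a b 𝓕 p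
  | turn {p : Position X} (S : Finset X) (hS : IsTurn a p S)
      (h : ∀ T, IsTurn b ⟨p.maker ∪ S, p.breaker⟩ T →
        MakerForces a b 𝓕 ⟨p.maker ∪ S, p.breaker ∪ T⟩) : MakerForces a b 𝓕 p

lemma exists_isTurn (k : ℕ) (p : Position X) : ∃ S, IsTurn k p S := by
  obtain ⟨S, hS, hc⟩ := Finset.exists_subset_card_eq (min_le_right k p.free.card)
  exact ⟨S, hS, hc⟩

lemma IsTurn.eq_empty {k : ℕ} {p : Position X} {S : Finset X} (h : IsTurn k p S)
    (hp : p.free = ∅) : S = ∅ := by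
  simpa [hp] using h.1

lemma MakerForces.exists_subset_of_free_eq_empty {a b : ℕ} {𝓕 : Set (Finset X)} {p : Position X}
    (h : MakerForces a b 𝓕 p) (hp : p.free = ∅) : ∃ F ∈ 𝓕, F ⊆ p.maker := by
  induction h with
  | claimed F hF hsub => exact ⟨F, hF, hsub⟩
  | @turn p S hS h ih =>
    obtain rfl := hS.eq_empty hp
    have hT : IsTurn b ⟨p.maker ∪ ∅, p.breaker⟩ ∅ := by
      refine ⟨Finset.empty_subset _, ?_⟩
      simp only [Finset.union_empty]
      change _ = min b p.free.card
      simp [hp]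
    simpa using ih ∅ hT (by simpa using hp)

/-- A strategy that always keeps `MakerForces` alive wins, because the number of unclaimed elements
decreases in every round until the board is exhausted. -/
theorem MakerForces.makerHasWinningStrategy {a b : ℕ} (ha : 1 ≤ a) {𝓕 : Set (Finset X)}
    (h : MakerForces a b 𝓕 ⟨∅, ∅⟩) : MakerHasWinningStrategy a b 𝓕 := by
  have key : ∀ p : Position X, ∃ S, IsTurn a p S ∧
      (MakerForces a b 𝓕 p → (∃ F ∈ 𝓕, F ⊆ p.maker) ∨
        ∀ T, IsTurn b ⟨p.maker ∪ S, p.breaker⟩ T →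
          MakerForces a b 𝓕 ⟨p.maker ∪ S, p.breaker ∪ T⟩) := by
    intro p
    by_cases hp : MakerForces a b 𝓕 p
    · cases hp with
      | claimed F hF hp =>
        obtain ⟨S, hS⟩ := exists_isTurn a p
        exact ⟨S, hS, fun _ => Or.inl ⟨F, hF, hp⟩⟩
      | turn S hS h => exact ⟨S, hS, fun _ => Or.inr h⟩
    · obtain ⟨S, hS⟩ := exists_isTurn a p
      exact ⟨S, hS, fun h => absurd h hp⟩
  choose σ hσ hwin using key
  refine ⟨σ, hσ, fun τ hτ => ?_⟩
  have main : ∀ k m : ℕ, (play σ τ m).free.card ≤ k → MakerForces a b 𝓕 (play σ τ m) →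
      ∃ m : ℕ, ∃ F ∈ 𝓕, F ⊆ (play σ τ m).maker := by
    intro k
    induction k with
    | zero =>
      intro m hm hf
      exact ⟨m, hf.exists_subset_of_free_eq_empty (by simpa using hm)⟩
    | succ k ih =>
      intro m hm hf
      rcases hwin _ hf with hF | hnext
      · exact ⟨m, hF⟩
      by_cases hfree : (play σ τ m).free = ∅
      · exact ⟨m, hf.exists_subset_of_free_eq_empty hfree⟩
      refine ih (m + 1) ?_ (hnext _ (hτ _))
      have hS := hσ (play σ τ m)
      have hpos : 1 ≤ (σ (play σ τ m)).card := by
        have := Finset.card_pos.2 (Finset.nonempty_iff_ne_empty.2 hfree)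
        rw [hS.2]; omega
      have hsub : (play σ τ (m + 1)).free ⊆ (play σ τ m).free \ σ (play σ τ m) := by
        intro x hx
        simp only [play, breakerTurn, makerTurn, Position.free, Finset.mem_compl,
          Finset.mem_union, Finset.mem_sdiff] at hx ⊢
        tauto
      have h1 := Finset.card_le_card hsub
      rw [Finset.card_sdiff_of_subset hS.1] at h1
      omega
  exact main _ 0 le_rfl h

/-- The number of claims that have been made in a position. -/
def Position.claims (p : Position X) : ℕ := p.maker.card + p.breaker.card

lemma Position.exists_mem_free {p : Position X} {A : Finset X} (h : p.claims < A.card) :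
    ∃ x ∈ A, x ∈ p.free := by
  by_contra! hA
  have hsub : A ⊆ p.maker ∪ p.breaker := fun x hx => by
    by_contra hx'
    exact hA x hx (Finset.mem_compl.2 hx')
  have h1 := Finset.card_le_card hsub
  have h2 := Finset.card_union_le p.maker p.breaker
  unfold Position.claims at h
  omega

lemma MakerForces.of_mem_free {b : ℕ} {𝓕 : Set (Finset X)} {p : Position X} {x : X}
    (hx : x ∈ p.free)
    (h : ∀ q : Position X, q.maker = insert x p.maker → q.claims ≤ p.claims + (b + 1) →
      MakerForces 1 b 𝓕 q) : MakerForces 1 b 𝓕 p := by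
  refine .turn {x} ⟨by simpa using hx, ?_⟩ fun T hT => h _ ?_ ?_
  · have := Finset.card_pos.2 ⟨x, hx⟩
    rw [Finset.card_singleton]; omega
  · ext y; simp
  · have h1 := Finset.card_union_le p.maker {x}
    have h2 := Finset.card_union_le p.breaker T
    have h3 : T.card ≤ b := hT.2.trans_le (min_le_left _ _)
    simp only [Finset.card_singleton] at h1
    simp only [Position.claims]
    omega

end Game

/-! ### Robust connections -/

section Reach

variable {V : Type*} [Fintype V] [DecidableEq V] (G : SimpleGraph V) [DecidableRel G.Adj]

open Classical in
/-- `Reach G t j u v` says that `u` and `v` are joined by even walks of length at most `2 ^ (j + 1)`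
in a robust way: at level `0` there are at least `t` common neighbours, and at level `j + 1` either
they are connected at level `j` or at least `t` vertices are connected at level `j` to both of
them. -/
def Reach (t : ℕ) : ℕ → V → V → Prop
  | 0, u, v => t ≤ (G.neighborFinset u ∩ G.neighborFinset v).card
  | j + 1, u, v => Reach t j u v ∨
      t ≤ (Finset.univ.filter fun w => Reach t j u w ∧ Reach t j w v).card

variable {G} {t : ℕ}

lemma Reach.symm {j : ℕ} {u v : V} (h : Reach G t j u v) : Reach G t j v u := by
  induction j generalizing u v with
  | zero => simpa [Reach, Finset.inter_comm] using h
  | succ j ih =>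
    refine h.imp ih fun h => h.trans (Finset.card_le_card fun w hw => ?_)
    simp only [Finset.mem_filter, Finset.mem_univ, true_and] at hw ⊢
    exact ⟨ih hw.2, ih hw.1⟩

lemma Reach.mono {i j : ℕ} (hij : i ≤ j) {u v : V} (h : Reach G t i u v) : Reach G t j u v := by
  induction hij with
  | refl => exact h
  | step _ ih => exact Or.inl ih

lemma Reach.refl (ht : t ≤ G.minDegree) (j : ℕ) (u : V) : Reach G t j u u := by
  refine Reach.mono (Nat.zero_le j) ?_
  simpa [Reach] using ht.trans (G.minDegree_le_degree u)

/-- From two claimed vertices that are connected at level `j`, Maker builds an even walk between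
them: he claims a free middle vertex, which leaves two connections of a lower level, and these he
completes one after the other. This takes at most `2 ^ (j + 1) - 1 ≤ 3 ^ j` rounds of `b + 1`
claims, so that `t` exceeds the number of claims made meanwhile. -/
theorem MakerForces.of_reach {b : ℕ} {𝓕 : Set (Finset V)} {j : ℕ} {u v : V}
    (hr : Reach G t j u v) {p : Position V} (hu : u ∈ p.maker) (hv : v ∈ p.maker)
    (ht : p.claims + (b + 1) * 3 ^ j ≤ t)
    (h : ∀ q : Position V, p.maker ⊆ q.maker → q.claims ≤ p.claims + (b + 1) * 3 ^ j →
      (∃ w : G.Walk u v, Even w.length ∧ w.length ≤ 2 ^ (j + 1) ∧ ∀ x ∈ w.support, x ∈ q.maker) →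
      MakerForces 1 b 𝓕 q) :
    MakerForces 1 b 𝓕 p := by
  induction j generalizing u v p with
  | zero =>
    obtain ⟨x, hx, hfree⟩ := Position.exists_mem_free
      (show p.claims < (G.neighborFinset u ∩ G.neighborFinset v).card by
        refine lt_of_lt_of_le ?_ hr; omega)
    simp only [Finset.mem_inter, SimpleGraph.mem_neighborFinset] at hx
    refine .of_mem_free (b := b) hfree fun q hq hc => h q ?_ (by omega) ?_
    · rw [hq]; exact Finset.subset_insert _ _
    · refine ⟨.cons hx.1 (.cons hx.2.symm .nil), by simp, by simp, ?_⟩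
      simp [hq, hu, hv]
  | succ j ih =>
    have hpow : (b + 1) * 3 ^ (j + 1) = 3 * ((b + 1) * 3 ^ j) := by ring
    have hle : b + 1 ≤ (b + 1) * 3 ^ j := Nat.le_mul_of_pos_right _ (by positivity)
    have hpow2 : 2 ^ (j + 1 + 1) = 2 * 2 ^ (j + 1) := by ring
    rcases hr with hr | hr
    · refine ih hr hu hv (by omega) fun q hq hc ⟨w, hw, hl, hs⟩ =>
        h q hq (by omega) ⟨w, hw, by omega, hs⟩
    · obtain ⟨x, hx, hfree⟩ := Position.exists_mem_free
        (lt_of_lt_of_le (show p.claims < t by omega) hr)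
      simp only [Finset.mem_filter, Finset.mem_univ, true_and] at hx
      refine .of_mem_free (b := b) hfree fun q₁ hq₁ hc₁ => ?_
      have hsub₁ : p.maker ⊆ q₁.maker := by rw [hq₁]; exact Finset.subset_insert _ _
      have hx₁ : x ∈ q₁.maker := by rw [hq₁]; exact Finset.mem_insert_self _ _
      refine ih hx.1 (hsub₁ hu) hx₁ (by omega) fun q₂ hq₂ hc₂ ⟨w₁, he₁, hl₁, hs₁⟩ => ?_
      refine ih hx.2 (hq₂ hx₁) (hq₂ (hsub₁ hv)) (by omega)
        fun q₃ hq₃ hc₃ ⟨w₂, he₂, hl₂, hs₂⟩ => ?_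
      refine h q₃ (hsub₁.trans (hq₂.trans hq₃)) (by omega) ⟨w₁.append w₂, ?_, ?_, ?_⟩
      · rw [SimpleGraph.Walk.length_append]; exact he₁.add he₂
      · rw [SimpleGraph.Walk.length_append]; omega
      · intro y hy
        rcases (SimpleGraph.Walk.mem_support_append_iff _ _).1 hy with hy | hy
        · exact hq₃ (hs₁ y hy)
        · exact hs₂ y hy

end Reach

/-! ### Odd closed walks -/

section OddCycle

variable {V : Type*} [DecidableEq V] {G : SimpleGraph V}

/-- Removing closed subwalks from a walk yields a path of the same parity, unless one of the
closed subwalks met on the way is an odd cycle. -/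
theorem exists_isPath_or_exists_odd_isCycle {u v : V} (p : G.Walk u v) :
    (∃ q : G.Walk u v, q.IsPath ∧ q.length ≤ p.length ∧ (Odd q.length ↔ Odd p.length) ∧
      q.support ⊆ p.support) ∨
    ∃ (x : V) (c : G.Walk x x), c.IsCycle ∧ Odd c.length ∧ c.length ≤ p.length ∧
      c.support ⊆ p.support := by
  induction p with
  | nil => exact Or.inl ⟨.nil, by simp⟩
  | @cons u v w h p ih =>
    rcases ih with ⟨q, hq, hl, hpar, hs⟩ | ⟨x, c, hc, hodd, hl, hs⟩
    · by_cases hu : u ∈ q.support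
      · have hlen : (q.takeUntil u hu).length + (q.dropUntil u hu).length = q.length := by
          rw [← SimpleGraph.Walk.length_append, q.take_spec hu]
        have hts := q.support_takeUntil_subset_support hu
        have hds := q.support_dropUntil_subset_support hu
        by_cases hodd : Odd ((q.takeUntil u hu).length + 1)
        · right
          refine ⟨u, .cons h (q.takeUntil u hu), ?_, by simpa using hodd, ?_, ?_⟩
          · rw [SimpleGraph.Walk.isCycle_iff_isPath_tail_and_le_length]
            refine ⟨by simpa using hq.takeUntil hu, ?_⟩
            have h0 : (q.takeUntil u hu).length ≠ 0 := fun h0 =>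
              h.ne (SimpleGraph.Walk.eq_of_length_eq_zero h0).symm
            obtain ⟨k, hk⟩ := hodd
            rw [SimpleGraph.Walk.length_cons]
            omega
          · rw [SimpleGraph.Walk.length_cons, SimpleGraph.Walk.length_cons]; omega
          · intro y hy
            rw [SimpleGraph.Walk.support_cons, List.mem_cons] at hy ⊢
            exact hy.imp_right fun hy => hs (hts hy)
        · left
          refine ⟨q.dropUntil u hu, hq.dropUntil hu, ?_, ?_, ?_⟩
          · rw [SimpleGraph.Walk.length_cons]; omega
          · rw [SimpleGraph.Walk.length_cons]
            grind
          · intro y hy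
            rw [SimpleGraph.Walk.support_cons, List.mem_cons]
            exact Or.inr (hs (hds hy))
      · left
        refine ⟨.cons h q, hq.cons hu, by simpa using hl, ?_, ?_⟩
        · simp only [SimpleGraph.Walk.length_cons]
          grind
        · intro y hy
          rw [SimpleGraph.Walk.support_cons, List.mem_cons] at hy ⊢
          exact hy.imp_right fun hy => hs hy
    · refine Or.inr ⟨x, c, hc, hodd, ?_, fun y hy => ?_⟩
      · rw [SimpleGraph.Walk.length_cons]; omega
      · rw [SimpleGraph.Walk.support_cons, List.mem_cons]
        exact Or.inr (hs hy)

theorem exists_mem_oddCycleVertexSets {v : V} (p : G.Walk v v) (hp : Odd p.length) {L : ℕ}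
    (hL : p.length ≤ L) : ∃ F ∈ oddCycleVertexSets G L, F ⊆ p.support.toFinset := by
  rcases exists_isPath_or_exists_odd_isCycle p with ⟨q, hq, -, hpar, -⟩ | ⟨x, c, hc, hodd, hl, hs⟩
  · rw [(SimpleGraph.Walk.isPath_iff_nil.1 hq).eq_nil] at hpar
    simp [hp] at hpar
  · exact ⟨_, ⟨x, c, hc, hodd, hl.trans hL, rfl⟩, fun y hy => by simpa using hs (by simpa using hy)⟩

end OddCycle

/-! ### Greedy colouring -/

section Colouring

variable {V : Type*} [Fintype V]

theorem colorable_succ_of_forall_degree_le (G : SimpleGraph V) [DecidableRel G.Adj] {b : ℕ}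
    (h : ∀ v, G.degree v ≤ b) : G.Colorable (b + 1) := by
  classical
  have key : ∀ s : Finset V, ∃ c : V → Fin (b + 1), ∀ u ∈ s, ∀ v ∈ s, G.Adj u v → c u ≠ c v := by
    intro s
    induction s using Finset.induction_on with
    | empty => exact ⟨fun _ => 0, by simp⟩
    | insert x s hx ih =>
      obtain ⟨c, hc⟩ := ih
      obtain ⟨i, hi⟩ : ∃ i, i ∉ (G.neighborFinset x).image c := by
        by_contra! hall
        have h1 := Finset.card_le_card (fun i _ => hall i : Finset.univ ⊆ _)
        have h2 := (Finset.card_image_le (s := G.neighborFinset x) (f := c)).trans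
          ((G.card_neighborFinset_eq_degree x).trans_le (h x))
        rw [Finset.card_univ, Fintype.card_fin] at h1
        omega
      have hi' : ∀ y, G.Adj x y → c y ≠ i := fun y hy he =>
        hi (Finset.mem_image.2 ⟨y, by simpa using hy, he⟩)
      refine ⟨Function.update c x i, fun u hu v hv huv => ?_⟩
      rcases Finset.mem_insert.1 hu with rfl | hu
      · rw [Function.update_self, Function.update_of_ne huv.ne']
        exact (hi' v huv).symm
      · rcases Finset.mem_insert.1 hv with rfl | hv
        · rw [Function.update_self, Function.update_of_ne huv.ne]
          exact hi' u huv.symm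
        · rw [Function.update_of_ne (ne_of_mem_of_not_mem hu hx),
            Function.update_of_ne (ne_of_mem_of_not_mem hv hx)]
          exact hc u hu v hv huv
  obtain ⟨c, hc⟩ := key Finset.univ
  exact ⟨SimpleGraph.Coloring.mk c fun {u v} huv => hc u (by simp) v (by simp) huv⟩

/-- If every vertex has at most `b` neighbours in its own class, then each class can be coloured
with its own set of `b + 1` colours. -/
theorem colorable_mul_succ_of_classes [DecidableEq V] (G : SimpleGraph V) [DecidableRel G.Adj]
    {b : ℕ} (S : Finset V) (f : V → V) (hf : ∀ v, f v ∈ S)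
    (h : ∀ v, ((G.neighborFinset v).filter fun w => f w = f v).card ≤ b) :
    G.Colorable (S.card * (b + 1)) := by
  classical
  let H : SimpleGraph V :=
    { Adj := fun u v => G.Adj u v ∧ f u = f v
      symm := ⟨fun _ _ h => ⟨h.1.symm, h.2.symm⟩⟩
      loopless := ⟨fun _ h => G.irrefl h.1⟩ }
  have hH : ∀ v, H.degree v ≤ b := by
    intro v
    refine le_trans (Finset.card_le_card fun w hw => ?_) (h v)
    have hw : H.Adj v w := by simpa using hw
    simpa using And.intro hw.1 hw.2.symm
  obtain ⟨c⟩ := colorable_succ_of_forall_degree_le H hH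
  let C : G.Coloring (S × Fin (b + 1)) := SimpleGraph.Coloring.mk (fun v => (⟨f v, hf v⟩, c v)) <| by
    intro u v huv he
    simp only [Prod.mk.injEq, Subtype.mk.injEq] at he
    exact c.valid (show H.Adj u v from ⟨huv, he.1⟩) he.2
  simpa using C.colorable

end Colouring

/-! ### Independent sets and classes of the robust connections -/

section Classes

variable {V : Type*} [Fintype V] [DecidableEq V] {G : SimpleGraph V} [DecidableRel G.Adj] {t : ℕ}

/-- Neighbourhoods with pairwise small intersections are nearly disjoint, hence there are few of
them. -/
lemma card_mul_minDegree_le {S : Finset V} (hS : (S : Set V).Pairwise fun u v => ¬Reach G t 0 u v) :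
    S.card * G.minDegree ≤ Fintype.card V + S.card * (S.card * t) := by
  let A : V → Finset V := fun s =>
    G.neighborFinset s \ (S.erase s).biUnion fun s' => G.neighborFinset s'
  have hA : ∀ s ∈ S, G.minDegree ≤ (A s).card + S.card * t := by
    intro s hs
    have h1 : G.minDegree ≤ (G.neighborFinset s).card := by
      simpa using G.minDegree_le_degree s
    have h2 := Finset.card_sdiff_add_card_inter (G.neighborFinset s)
      ((S.erase s).biUnion fun s' => G.neighborFinset s')
    have h3 : (G.neighborFinset s ∩ (S.erase s).biUnion fun s' => G.neighborFinset s').card ≤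
        (S.erase s).card * t := by
      rw [Finset.inter_biUnion]
      refine Finset.card_biUnion_le_card_mul _ _ _ fun s' hs' => ?_
      rw [Finset.mem_erase] at hs'
      exact (not_le.1 (hS hs hs'.2 hs'.1.symm)).le
    have h4 : (S.erase s).card * t ≤ S.card * t :=
      Nat.mul_le_mul_right _ (Finset.card_le_card (Finset.erase_subset _ _))
    change _ ≤ (G.neighborFinset s \ _).card + _
    omega
  have hdisj : (S : Set V).PairwiseDisjoint A := by
    intro s hs s' hs' hne
    refine Finset.disjoint_left.2 fun x hx hx' => ?_
    refine (Finset.mem_sdiff.1 hx).2 (Finset.mem_biUnion.2 ⟨s', ?_, (Finset.mem_sdiff.1 hx').1⟩)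
    exact Finset.mem_erase.2 ⟨hne.symm, hs'⟩
  calc S.card * G.minDegree = ∑ _s ∈ S, G.minDegree := by simp
    _ ≤ ∑ s ∈ S, ((A s).card + S.card * t) := Finset.sum_le_sum hA
    _ = (S.biUnion A).card + S.card * (S.card * t) := by
      rw [Finset.sum_add_distrib, Finset.card_biUnion hdisj]; simp
    _ ≤ _ := Nat.add_le_add_right (Finset.card_le_univ _) _

open Classical in
lemma minDegree_mul_minDegree_le (v : V) :
    G.minDegree * G.minDegree ≤
      Fintype.card V * (t + (Finset.univ.filter fun w => Reach G t 0 v w).card) := by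
  have h1 : ∑ w, (G.neighborFinset v ∩ G.neighborFinset w).card =
      ∑ x ∈ G.neighborFinset v, G.degree x := by
    have := Finset.sum_card_bipartiteAbove_eq_sum_card_bipartiteBelow
      (s := Finset.univ) (t := G.neighborFinset v) (fun w x => G.Adj w x)
    convert this using 2 with w _ x _
    · congr 1; ext x; simp [Finset.bipartiteAbove]
    · rw [← G.card_neighborFinset_eq_degree]
      congr 1; ext w; simp [Finset.bipartiteBelow, G.adj_comm]
  calc G.minDegree * G.minDegree
      ≤ (G.neighborFinset v).card * G.minDegree :=
        Nat.mul_le_mul_right _ (by simpa using G.minDegree_le_degree v)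
    _ = ∑ _x ∈ G.neighborFinset v, G.minDegree := by simp
    _ ≤ ∑ x ∈ G.neighborFinset v, G.degree x :=
        Finset.sum_le_sum fun x _ => G.minDegree_le_degree x
    _ = ∑ w, (G.neighborFinset v ∩ G.neighborFinset w).card := h1.symm
    _ ≤ ∑ w, (t + if Reach G t 0 v w then Fintype.card V else 0) := by
        refine Finset.sum_le_sum fun w _ => ?_
        split_ifs with hw
        · exact (Finset.card_le_univ _).trans (Nat.le_add_left _ _)
        · exact (not_le.1 hw).le
    _ = _ := by
        rw [Finset.sum_add_distrib, ← Finset.sum_filter]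
        simp only [Finset.sum_const, Finset.card_univ, smul_eq_mul]
        ring

/-- The largest size of an independent set cannot increase with the level, and it stays between `0`
and `M`, so some two consecutive levels agree on it. -/
lemma exists_level {M : ℕ}
    (hM : ∀ S : Finset V, (S : Set V).Pairwise (fun u v => ¬Reach G t 0 u v) → S.card ≤ M) :
    ∃ j ≤ M, ∃ S : Finset V, (S : Set V).Pairwise (fun u v => ¬Reach G t (j + 1) u v) ∧
      ∀ T : Finset V, (T : Set V).Pairwise (fun u v => ¬Reach G t j u v) → T.card ≤ S.card := by
  by_contra! hcon
  have key : ∀ i ≤ M + 1, ∃ T : Finset V,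
      (T : Set V).Pairwise (fun u v => ¬Reach G t (M + 1 - i) u v) ∧ i ≤ T.card := by
    intro i
    induction i with
    | zero => exact fun _ => ⟨∅, by simp, by simp⟩
    | succ i ih =>
      intro hi
      obtain ⟨S, hS, hc⟩ := ih (by omega)
      rw [show M + 1 - i = M + 1 - (i + 1) + 1 by omega] at hS
      obtain ⟨T, hT, hlt⟩ := hcon _ (by omega) S hS
      exact ⟨T, hT, by omega⟩
  obtain ⟨T, hT, hc⟩ := key (M + 1) le_rfl
  rw [Nat.sub_self] at hT
  have := hM T hT
  omega

/-- The vertices split into at most `M` classes, each of them robustly connected. A set `S` of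
representatives is independent at level `j + 1` and at least as large as every independent set of
level `j`. The vertices that are connected at level `j` to exactly one element `s` of `S` are
connected to each other at level `j`, since otherwise two of them could replace `s` and give a
larger independent set; few vertices are connected to two elements of `S`. So every vertex has `t`
neighbours (in the sense of level `0`) that belong to the same `s`, and this `s` determines its
class. -/
theorem exists_classes {M : ℕ} (ht : 0 < t) (hM₀ : 0 < M) (htD : t ≤ G.minDegree)
    (hM : ∀ S : Finset V, (S : Set V).Pairwise (fun u v => ¬Reach G t 0 u v) → S.card ≤ M)
    (hR : ∀ v, ∃ W : Finset V, (∀ w ∈ W, Reach G t 0 v w) ∧ (M + 1) ^ 2 * t ≤ t + W.card) :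
    ∃ S : Finset V, S.card ≤ M ∧ ∃ f : V → V, (∀ v, f v ∈ S) ∧
      ∀ u v, f u = f v → Reach G t (M + 2) u v := by
  classical
  obtain ⟨j, hj, S, hS, hmax⟩ := exists_level hM
  have hSj : (S : Set V).Pairwise fun u v => ¬Reach G t j u v :=
    hS.imp fun u v h h' => h (Reach.mono (Nat.le_succ j) h')
  have hSM : S.card ≤ M := hM S (hS.imp fun u v h h' => h (Reach.mono (Nat.zero_le _) h'))
  have hcover : ∀ w, ∃ s ∈ S, Reach G t j w s := by
    intro w
    by_contra! hw
    have hwS : w ∉ S := fun h => hw w h (Reach.refl htD j w)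
    have := hmax (insert w S) (by
      rw [Finset.coe_insert]
      exact hSj.insert fun s hs _ => ⟨hw s hs, fun h => hw s hs h.symm⟩)
    rw [Finset.card_insert_of_notMem hwS] at this
    omega
  let U : V → Finset V := fun s =>
    Finset.univ.filter fun w => Reach G t j w s ∧ ∀ s' ∈ S, s' ≠ s → ¬Reach G t j w s'
  have hU : ∀ s ∈ S, ∀ x ∈ U s, ∀ y ∈ U s, Reach G t j x y := by
    intro s hs x hx y hy
    simp only [U, Finset.mem_filter, Finset.mem_univ, true_and] at hx hy
    by_contra hxy
    have hne : x ≠ y := fun h => hxy (h ▸ Reach.refl htD j x)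
    have hfar : ∀ z, (∀ s' ∈ S, s' ≠ s → ¬Reach G t j z s') → ∀ s' ∈ S.erase s,
        ¬Reach G t j z s' := fun z hz s' hs' =>
      hz s' (Finset.mem_of_mem_erase hs') (Finset.ne_of_mem_erase hs')
    have hy' : y ∉ S.erase s := fun h => hfar y hy.2 y h (Reach.refl htD j y)
    have hx' : x ∉ insert y (S.erase s) := by
      rw [Finset.mem_insert, not_or]
      exact ⟨hne, fun h => hfar x hx.2 x h (Reach.refl htD j x)⟩
    have := hmax (insert x (insert y (S.erase s))) (by
      rw [Finset.coe_insert, Finset.coe_insert]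
      refine Set.Pairwise.insert (Set.Pairwise.insert ?_ ?_) ?_
      · exact hSj.mono (by simp)
      · exact fun z hz _ => ⟨hfar y hy.2 z hz, fun h => hfar y hy.2 z hz h.symm⟩
      · rintro z (rfl | hz) _
        · exact ⟨hxy, fun h => hxy h.symm⟩
        · exact ⟨hfar x hx.2 z hz, fun h => hfar x hx.2 z hz h.symm⟩)
    rw [Finset.card_insert_of_notMem hx', Finset.card_insert_of_notMem hy',
      Finset.card_erase_of_mem hs] at this
    have := Finset.card_pos.2 ⟨s, hs⟩
    omega
  -- The vertices that are connected to two elements of `S`.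
  let B : Finset V := S.offDiag.biUnion fun e =>
    Finset.univ.filter fun w => Reach G t j e.1 w ∧ Reach G t j w e.2
  have hB : B.card ≤ M ^ 2 * t := by
    have h1 : B.card ≤ S.offDiag.card * t := by
      refine Finset.card_biUnion_le_card_mul _ _ _ fun e he => ?_
      rw [Finset.mem_offDiag] at he
      exact (not_le.1 fun h => hS he.1 he.2.1 he.2.2 (Or.inr h)).le
    have h2 : S.offDiag.card ≤ M ^ 2 := by
      rw [Finset.offDiag_card, sq]
      exact (Nat.sub_le _ _).trans (Nat.mul_le_mul hSM hSM)
    exact h1.trans (Nat.mul_le_mul_right _ h2)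
  have hclass : ∀ v, ∃ s ∈ S, t ≤ ((U s).filter fun w => Reach G t 0 v w).card := by
    intro v
    obtain ⟨W, hW, hcard⟩ := hR v
    by_contra! hsmall
    have hsub : W ⊆ B ∪ S.biUnion fun s => (U s).filter fun w => Reach G t 0 v w := by
      intro w hw
      obtain ⟨s, hs, hws⟩ := hcover w
      rw [Finset.mem_union]
      by_cases hother : ∃ s' ∈ S, s' ≠ s ∧ Reach G t j w s'
      · obtain ⟨s', hs', hne, hws'⟩ := hother
        left
        refine Finset.mem_biUnion.2 ⟨(s, s'), Finset.mem_offDiag.2 ⟨hs, hs', hne.symm⟩, ?_⟩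
        simpa using And.intro hws.symm hws'
      · push Not at hother
        right
        refine Finset.mem_biUnion.2 ⟨s, hs, ?_⟩
        simpa [U] using And.intro (And.intro hws hother) (hW w hw)
    have h1 := (Finset.card_le_card hsub).trans (Finset.card_union_le _ _)
    have h2 := Finset.card_biUnion_le_card_mul S
      (fun s => (U s).filter fun w => Reach G t 0 v w) t fun s hs => (hsmall s hs).le
    have h3 : S.card * t ≤ M * t := Nat.mul_le_mul_right _ hSM
    have h4 : 0 < M * t := Nat.mul_pos hM₀ ht
    have h5 : (M + 1) ^ 2 * t = M ^ 2 * t + 2 * (M * t) + t := by ring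
    omega
  choose f hfS hf using hclass
  refine ⟨S, hSM, f, hfS, fun u v huv => Reach.mono (by omega : j + 2 ≤ M + 2) ?_⟩
  refine Or.inr ((hf u).trans (Finset.card_le_card fun w hw => ?_))
  rw [Finset.mem_filter] at hw
  refine Finset.mem_filter.2 ⟨Finset.mem_univ _, Reach.mono (Nat.zero_le _) hw.2, ?_⟩
  refine Or.inr ((hf v).trans (Finset.card_le_card fun w' hw' => ?_))
  rw [Finset.mem_filter] at hw'
  refine Finset.mem_filter.2 ⟨Finset.mem_univ _, ?_, Reach.mono (Nat.zero_le _) hw'.2.symm⟩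
  exact hU _ (hfS u) w hw.1 w' (huv ▸ hw'.1)

end Classes

/-! ### Winning the odd cycle game -/

section Win

variable {V : Type*} [Fintype V] [DecidableEq V] {G : SimpleGraph V} [DecidableRel G.Adj]

/-- Maker claims a vertex with more than `b` neighbours in its own class, then one of these
neighbours, and closes this edge by an even walk. -/
theorem makerForces_oddCycle {b t j : ℕ} (f : V → V)
    (hf : ∀ u v, f u = f v → Reach G t j u v) (ht : (b + 1) * (3 ^ j + 2) ≤ t) {u : V}
    (hu : b < ((G.neighborFinset u).filter fun w => f w = f u).card) :
    MakerForces 1 b (oddCycleVertexSets G (2 ^ (j + 1) + 1)) ⟨∅, ∅⟩ := by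
  have hbudget : (b + 1) * (3 ^ j + 2) = (b + 1) * 3 ^ j + 2 * (b + 1) := by ring
  refine .of_mem_free (x := u) (b := b) (by simp [Position.free]) fun q₁ hq₁ hc₁ => ?_
  replace hq₁ : q₁.maker = {u} := by simpa using hq₁
  simp only [Position.claims, Finset.card_empty] at hc₁
  obtain ⟨v, hv, hfree⟩ : ∃ v ∈ insert u ((G.neighborFinset u).filter fun w => f w = f u),
      v ∈ q₁.free := by
    refine Position.exists_mem_free ?_
    rw [Finset.card_insert_of_notMem (by simp)]
    simp only [Position.claims]
    omega
  have hvu : v ≠ u := by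
    rintro rfl
    simp [Position.free, hq₁] at hfree
  simp only [Finset.mem_insert, hvu, false_or, Finset.mem_filter,
    SimpleGraph.mem_neighborFinset] at hv
  refine .of_mem_free (b := b) hfree fun q₂ hq₂ hc₂ => ?_
  simp only [Position.claims] at hc₂
  refine .of_reach (hf v u hv.2) (by simp [hq₂]) (by simp [hq₂, hq₁])
    (by simp only [Position.claims]; omega) fun q₃ hq₃ _ ⟨w, he, hl, hs⟩ => ?_
  obtain ⟨F, hF, hsub⟩ := exists_mem_oddCycleVertexSets (.cons hv.1 w)
    (by simpa using he.add_one) (show _ ≤ 2 ^ (j + 1) + 1 by simpa using hl)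
  refine .claimed F hF (hsub.trans fun y hy => ?_)
  simp only [SimpleGraph.Walk.support_cons, List.toFinset_cons, Finset.mem_insert,
    List.mem_toFinset] at hy
  rcases hy with rfl | hy
  · exact hq₃ (by simp [hq₂, hq₁])
  · exact hs y hy

end Win

end MakerBreaker

theorem theorem1p3 (δ : ℝ) (hδ₀ : 0 < δ) (hδ₁ : δ < 1) :
    ∃ L : ℕ, ∀ b : ℕ, 1 ≤ b → ∃ n₀ : ℕ,
      ∀ (V : Type*) [Fintype V] [DecidableEq V] (G : SimpleGraph V) [DecidableRel G.Adj],
        n₀ ≤ Fintype.card V →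
        δ * (Fintype.card V : ℝ) ≤ (G.minDegree : ℝ) →
        2 * ((b : ℝ) + 1) / δ < (G.chromaticNumber.toNat : ℝ) →
        MakerBreaker.MakerHasWinningStrategy 1 b (MakerBreaker.oddCycleVertexSets G L) := by
  -- `M` bounds the number of classes, and `t` exceeds the number of claims made until
  -- Maker has won.
  set M := ⌊2 / δ⌋₊ with hMdef
  have hM2 : (M : ℝ) ≤ 2 / δ := Nat.floor_le (by positivity)
  have hM₀ : 0 < M := Nat.floor_pos.2 (by rw [le_div_iff₀ hδ₀]; linarith)
  have hM3 : 2 < ((M : ℝ) + 1) * δ := by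
    rw [← div_lt_iff₀ hδ₀]; exact Nat.lt_floor_add_one _
  refine ⟨2 ^ (M + 2 + 1) + 1, fun b _ => ?_⟩
  set t := (b + 1) * (3 ^ (M + 2) + 2) with htdef
  have ht₀ : 0 < t := by positivity
  refine ⟨⌈((M : ℝ) + 1) ^ 2 * t / δ ^ 2⌉₊, fun V _ _ G _ hn hdeg hχ => ?_⟩
  have hnt : ((M : ℝ) + 1) ^ 2 * t ≤ δ ^ 2 * Fintype.card V := by
    have := Nat.ceil_le.1 hn
    rwa [div_le_iff₀ (by positivity), mul_comm (_ : ℝ) (δ ^ 2)] at this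
  have htR : (0 : ℝ) < t := by exact_mod_cast ht₀
  have hn₀ : (0 : ℝ) < Fintype.card V := by
    have : 0 < δ ^ 2 * (Fintype.card V : ℝ) := lt_of_lt_of_le (by positivity) hnt
    exact pos_of_mul_pos_right this (by positivity)
  have hδ2 : δ ^ 2 ≤ δ := by nlinarith
  have htD : t ≤ G.minDegree := by
    have h1 : (t : ℝ) ≤ ((M : ℝ) + 1) ^ 2 * t :=
      le_mul_of_one_le_left htR.le (one_le_pow₀ (by linarith [(Nat.cast_nonneg M : (0 : ℝ) ≤ M)]))
    have h2 : δ ^ 2 * (Fintype.card V : ℝ) ≤ δ * Fintype.card V := by gcongr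
    exact_mod_cast h1.trans (hnt.trans (h2.trans hdeg))
  have hindep : ∀ S : Finset V,
      (S : Set V).Pairwise (fun u v => ¬MakerBreaker.Reach G t 0 u v) → S.card ≤ M := by
    intro S hS
    by_contra! hlt
    obtain ⟨T, hTS, hT⟩ := Finset.exists_subset_card_eq (show M + 1 ≤ S.card from hlt)
    have h1 := MakerBreaker.card_mul_minDegree_le (hS.mono (Finset.coe_subset.2 hTS))
    rw [hT] at h1
    have h2 : ((M : ℝ) + 1) * G.minDegree ≤
        Fintype.card V + ((M : ℝ) + 1) * (((M : ℝ) + 1) * t) := by exact_mod_cast h1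
    have h3 : ((M : ℝ) + 1) * (δ * Fintype.card V) ≤ ((M : ℝ) + 1) * G.minDegree := by gcongr
    have h4 : 2 * (Fintype.card V : ℝ) < ((M : ℝ) + 1) * δ * Fintype.card V := by gcongr
    have h5 : δ ^ 2 * (Fintype.card V : ℝ) ≤ 1 * Fintype.card V := by
      gcongr; linarith
    linarith
  have hreach : ∀ v, ∃ W : Finset V, (∀ w ∈ W, MakerBreaker.Reach G t 0 v w) ∧
      (M + 1) ^ 2 * t ≤ t + W.card := by
    intro v
    classical
    refine ⟨Finset.univ.filter fun w => MakerBreaker.Reach G t 0 v w, by simp, ?_⟩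
    have h1 : (G.minDegree : ℝ) * G.minDegree ≤ Fintype.card V *
        (t + (Finset.univ.filter fun w => MakerBreaker.Reach G t 0 v w).card) := by
      have := MakerBreaker.minDegree_mul_minDegree_le (G := G) (t := t) v
      exact_mod_cast this
    have h2 : (δ * Fintype.card V) * (δ * Fintype.card V) ≤ (G.minDegree : ℝ) * G.minDegree := by
      gcongr
    have h3 : (Fintype.card V : ℝ) * (δ ^ 2 * Fintype.card V) ≤ Fintype.card V *
        (t + (Finset.univ.filter fun w => MakerBreaker.Reach G t 0 v w).card) := by
      linarith
    have h4 := hnt.trans (le_of_mul_le_mul_left h3 hn₀)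
    exact_mod_cast h4
  obtain ⟨S, hSM, f, hfS, hf⟩ := MakerBreaker.exists_classes ht₀ hM₀ htD hindep hreach
  obtain ⟨u, hu⟩ : ∃ u, b < ((G.neighborFinset u).filter fun w => f w = f u).card := by
    by_contra! hall
    have hcol := MakerBreaker.colorable_mul_succ_of_classes G S f hfS hall
    have h1 : G.chromaticNumber.toNat ≤ S.card * (b + 1) :=
      ENat.toNat_le_of_le_natCast hcol.chromaticNumber_le
    have h2 : (G.chromaticNumber.toNat : ℝ) ≤ (M : ℝ) * (b + 1) := by
      exact_mod_cast h1.trans (Nat.mul_le_mul_right _ hSM)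
    have h3 : (M : ℝ) * (b + 1) ≤ 2 / δ * (b + 1) := by gcongr
    have h4 : 2 / δ * ((b : ℝ) + 1) = 2 * (b + 1) / δ := by ring
    linarith
  exact (MakerBreaker.makerForces_oddCycle f hf le_rfl hu).makerHasWinningStrategy le_rfl
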